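/- Let $S$ be a connected $C^2$-smooth immersed surface in Euclidean space $\mathbb{E}^3$, oriented by a unit normal field, which is rotationally symmetric about some axis, i.e. invariant under all rotations about that axis (for an immersed surface: the rotations about the axis lift to a continuous one-parameter group of transformations of the surface). Let $k_1$ and $k_2$ be the principal curvatures of $S$ in the direction of the parallels (the circles about the axis) and in the direction of the profile curves, respectively; at points of $S$ on the axis the two coincide. Suppose that $S$ is a semi-quadratic Weingarten surface, i.e. there are real numbers $(\alpha,\beta,\gamma,\delta)\neq(0,0,0,0)$ such that $$\alpha k_1k_2+\beta k_1+\gamma k_2+\delta=0$$ at every point of $S$, and suppose that $\Lambda_1^2=\Lambda_2$, where $$\Lambda_1=\beta-\gamma,\qquad \Lambda_2=(\beta+\gamma)^2-4\alpha\delta.$$ Then $S$ is a subset of a torus of revolution, a round sphere, a plane, a circular cone or a circular cylinder. Here a torus of revolution is the set swept out by a circle of positive radius rotating about a line in its plane that does not pass through its centre; the circle is allowed to meet this line, so that the torus may be self-intersecting. -/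

import Mathlib

open scoped Manifold ContDiff

/-- The model space of surfaces. -/
abbrev EuclPlane : Type := EuclideanSpace ℝ (Fin 2)

/-- Euclidean three-space. -/
abbrev EuclSpace : Type := EuclideanSpace ℝ (Fin 3)

/-- Rotation of Euclidean three-space through the angle `t` about the third coordinate axis. -/
noncomputable def rotateZ (t : ℝ) (x : EuclSpace) : EuclSpace :=
  !₂[Real.cos t * x 0 - Real.sin t * x 1, Real.sin t * x 0 + Real.cos t * x 1, x 2]

section Surfaces

variable {M : Type*} [TopologicalSpace M] [ChartedSpace EuclPlane M]

/-- The differential at `p` of a map from a surface to Euclidean three-space, with the tangent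
spaces of three-space identified with three-space itself. -/
noncomputable def surfDiff (f : M → EuclSpace) (p : M) :
    TangentSpace 𝓘(ℝ, EuclPlane) p →L[ℝ] EuclSpace :=
  mfderiv 𝓘(ℝ, EuclPlane) 𝓘(ℝ, EuclSpace) f p

/-- `f` is an immersion of class `C²` of the surface `M` in Euclidean three-space. Embedded surfaces
are the case where `M` is a subset of three-space and `f` is the inclusion. -/
structure IsC2ImmersedSurface (f : M → EuclSpace) : Prop where
  contMDiff : ContMDiff 𝓘(ℝ, EuclPlane) 𝓘(ℝ, EuclSpace) 2 f
  injective_diff : ∀ p : M, Function.Injective (surfDiff f p)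

/-- `N` is a unit normal field of class `C¹` along the immersed surface `f`. -/
structure IsUnitNormalField (f N : M → EuclSpace) : Prop where
  contMDiff : ContMDiff 𝓘(ℝ, EuclPlane) 𝓘(ℝ, EuclSpace) 1 N
  norm_eq_one : ∀ p : M, ‖N p‖ = 1
  normal : ∀ (p : M) (v : TangentSpace 𝓘(ℝ, EuclPlane) p), inner ℝ (N p) (surfDiff f p v) = 0

/-- The immersed surface `f` is rotationally symmetric about the third axis of the Cartesian
coordinate system `A`: the rotations about this axis lift to a continuous one-parameter group of
transformations of `M`. For a subset of three-space included in three-space this says that the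
subset is invariant under all rotations about the axis. -/
def IsRotationallySymmetric (A : EuclSpace ≃ᵃⁱ[ℝ] EuclSpace) (f : M → EuclSpace) : Prop :=
  ∃ Φ : ℝ → M → M,
    Continuous (fun q : ℝ × M => Φ q.1 q.2) ∧
    (∀ p, Φ 0 p = p) ∧
    (∀ s t p, Φ (s + t) p = Φ s (Φ t p)) ∧
    ∀ t p, A (f (Φ t p)) = rotateZ t (A (f p))

/-- In the coordinates `A`, the tangent vector `w` at the point `y` is tangent to the parallel (the
circle about the third axis) through `y`: it is orthogonal to the axis and to the radial
direction. If `y` lies on the axis, then every vector orthogonal to the axis qualifies. -/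
def IsParallelDirection (A : EuclSpace ≃ᵃⁱ[ℝ] EuclSpace) (y w : EuclSpace) : Prop :=
  A.linearIsometryEquiv w 2 = 0 ∧
    A y 0 * A.linearIsometryEquiv w 0 + A y 1 * A.linearIsometryEquiv w 1 = 0

/-- In the coordinates `A`, the tangent vector `w` at the point `y` is tangent to a plane that
contains `y` and the third axis, which is the plane of the profile curve through `y`. If `y` lies
on the axis, then every vector qualifies. -/
def IsProfileDirection (A : EuclSpace ≃ᵃⁱ[ℝ] EuclSpace) (y w : EuclSpace) : Prop :=
  A y 0 * A.linearIsometryEquiv w 1 - A y 1 * A.linearIsometryEquiv w 0 = 0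

/-- `k₁` and `k₂` are the principal curvatures, with respect to the unit normal field `N`, of the
surface `f` which is rotationally symmetric about the third axis of `A`: the eigenvalues of the shape
operator `-dN`, where `k₁` belongs to the parallels and `k₂` to the profile curves. At points
on the axis, where all tangent directions are both, the two coincide. -/
structure ArePrincipalCurvatures (A : EuclSpace ≃ᵃⁱ[ℝ] EuclSpace) (f N : M → EuclSpace)
    (k₁ k₂ : M → ℝ) : Prop where
  parallel : ∀ (p : M) (v : TangentSpace 𝓘(ℝ, EuclPlane) p),
    IsParallelDirection A (f p) (surfDiff f p v) → -(surfDiff N p v) = k₁ p • surfDiff f p v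
  profile : ∀ (p : M) (v : TangentSpace 𝓘(ℝ, EuclPlane) p),
    IsProfileDirection A (f p) (surfDiff f p v) → -(surfDiff N p v) = k₂ p • surfDiff f p v

end Surfaces

/-- The semi-quadratic Weingarten relation `α k₁ k₂ + β k₁ + γ k₂ + δ = 0`, with coefficients
that are not all zero, between two functions on a surface. -/
structure IsSemiQuadraticWeingarten {M : Type*} (α β γ δ : ℝ) (k₁ k₂ : M → ℝ) : Prop where
  nontrivial : (α, β, γ, δ) ≠ (0, 0, 0, 0)
  relation : ∀ p : M, α * (k₁ p * k₂ p) + β * k₁ p + γ * k₂ p + δ = 0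

/-- The quantity `Λ₁` of a semi-quadratic Weingarten relation. -/
def weingartenLambda₁ (β γ : ℝ) : ℝ := β - γ

/-- The quantity `Λ₂` of a semi-quadratic Weingarten relation. -/
def weingartenLambda₂ (α β γ δ : ℝ) : ℝ := (β + γ) ^ 2 - 4 * α * δ

/-- Signed height of `x` along the line through `c` with unit direction `u`. -/
noncomputable def axisHeight (c u x : EuclSpace) : ℝ := inner ℝ u (x - c)

/-- Distance of `x` from the line through `c` with unit direction `u`. -/
noncomputable def axisDist (c u x : EuclSpace) : ℝ := ‖(x - c) - axisHeight c u x • u‖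

/-- A torus of revolution: a circle of radius `r` in a plane containing the axis, with centre at
distance `R > 0` from the axis, rotated about the axis. The circle may meet the axis (`R ≤ r`), and
then its part beyond the axis sweeps out the points given by the second equation. -/
def IsTorusOfRevolution (T : Set EuclSpace) : Prop :=
  ∃ (c u : EuclSpace) (R r : ℝ), ‖u‖ = 1 ∧ 0 < R ∧ 0 < r ∧
    T = {x | (axisDist c u x - R) ^ 2 + axisHeight c u x ^ 2 = r ^ 2 ∨
      (-axisDist c u x - R) ^ 2 + axisHeight c u x ^ 2 = r ^ 2}

def IsRoundSphere (T : Set EuclSpace) : Prop :=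
  ∃ (c : EuclSpace) (r : ℝ), 0 < r ∧ T = Metric.sphere c r

def IsAffinePlane (T : Set EuclSpace) : Prop :=
  ∃ c u : EuclSpace, ‖u‖ = 1 ∧ T = {x | axisHeight c u x = 0}

/-- A (one-sided, infinite) circular cone with apex `c`. -/
def IsCircularCone (T : Set EuclSpace) : Prop :=
  ∃ (c u : EuclSpace) (m : ℝ), ‖u‖ = 1 ∧ 0 < m ∧ T = {x | axisDist c u x = m * axisHeight c u x}

def IsCircularCylinder (T : Set EuclSpace) : Prop :=
  ∃ (c u : EuclSpace) (r : ℝ), ‖u‖ = 1 ∧ 0 < r ∧ T = {x | axisDist c u x = r}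

/-! The condition `Λ₁² = Λ₂` says `βγ = αδ`, so the Weingarten relation splits into linear factors:
at each point `k₁ = a` or `k₂ = b` for constants `a`, `b`
(`IsSemiQuadraticWeingarten.exists_eq_or_eq`). Which factor vanishes may vary from point to point,
and excluding such gluing is the heart of the proof.

On the open set where `k₂ ≠ b` the parallel curvature is constantly `a`. The horizontal part of the
normal is `-k₁` times the horizontal position; differentiating this along a profile direction forces
`k₂ = a` or a vertical profile direction, hence `k₂ = 0` (`eq_or_eq_zero_of_const`). So `k₂` takes
values in the finite set `{a, 0, b}`; it is continuous, also at the axis, and therefore constant on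
the connected surface.

If the constant is nonzero, the centres of curvature of the profile curves keep their height and
their distance from the axis, which gives a torus, or a sphere if that distance is zero
(`torus_or_sphere_of_const`). If it is zero, the vertical component of the normal and the support
function are constant, which gives a plane, cone or cylinder (`plane_or_cone_or_cylinder_of_zero`).
All constancy statements come from vanishing derivatives in charts, so no profile curve is ever
parametrized. -/

/-- A coordinate patch of a surface which is rotationally symmetric about the third axis: an immersion
`F`, its unit normal `G`, and the principal curvatures belonging to the parallels and to the profile
curves. -/
structure IsRotationalPatch (U : Set EuclPlane) (F G : EuclPlane → EuclSpace)
    (κ₁ κ₂ : EuclPlane → ℝ) : Prop where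
  isOpen : IsOpen U
  contDiffOn : ContDiffOn ℝ 1 F U
  contDiffOn_normal : ContDiffOn ℝ 1 G U
  injective : ∀ x ∈ U, Function.Injective (fderiv ℝ F x)
  unit : ∀ x ∈ U, G x 0 ^ 2 + G x 1 ^ 2 + G x 2 ^ 2 = 1
  normal : ∀ x ∈ U, ∀ v, G x 0 * fderiv ℝ F x v 0 + G x 1 * fderiv ℝ F x v 1
    + G x 2 * fderiv ℝ F x v 2 = 0
  radial : ∀ x ∈ U, F x 0 * G x 1 - F x 1 * G x 0 = 0
  parallel : ∀ x ∈ U, ∀ v, fderiv ℝ F x v 2 = 0 →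
    F x 0 * fderiv ℝ F x v 0 + F x 1 * fderiv ℝ F x v 1 = 0 →
    -(fderiv ℝ G x v) = κ₁ x • fderiv ℝ F x v
  profile : ∀ x ∈ U, ∀ v, F x 0 * fderiv ℝ F x v 1 - F x 1 * fderiv ℝ F x v 0 = 0 →
    -(fderiv ℝ G x v) = κ₂ x • fderiv ℝ F x v

/-- An injective linear map from the plane to the orthogonal complement of a nonzero vector of
three-space is onto. -/
theorem exists_apply_eq_of_orthogonal (L : EuclPlane →L[ℝ] EuclSpace) (hL : Function.Injective L)
    (n y : EuclSpace) (hn : n ≠ 0) (h : ∀ v, inner ℝ n (L v) = 0) (hy : inner ℝ n y = 0) :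
    ∃ v, L v = y := by
  have h1 : LinearMap.range L.toLinearMap = (ℝ ∙ n)ᗮ := by
    apply Submodule.eq_of_le_of_finrank_eq
    · rintro _ ⟨v, rfl⟩
      exact Submodule.mem_orthogonal_singleton_iff_inner_right.2 (h v)
    · rw [LinearMap.finrank_range_of_inj hL]
      have : Fact (Module.finrank ℝ EuclSpace = 2 + 1) := ⟨by simp⟩
      rw [Submodule.finrank_orthogonal_span_singleton (n := 2) hn]
      simp
  have h2 : y ∈ LinearMap.range L.toLinearMap := by
    rw [h1]
    exact Submodule.mem_orthogonal_singleton_iff_inner_right.2 hy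
  exact h2

/-! ### Pointwise geometry of a rotational patch -/

namespace IsRotationalPatch

variable {U : Set EuclPlane} {F G : EuclPlane → EuclSpace} {κ₁ κ₂ : EuclPlane → ℝ}
  {x : EuclPlane}

theorem mono (h : IsRotationalPatch U F G κ₁ κ₂) {V : Set EuclPlane} (hV : IsOpen V)
    (hVU : V ⊆ U) : IsRotationalPatch V F G κ₁ κ₂ where
  isOpen := hV
  contDiffOn := h.contDiffOn.mono hVU
  contDiffOn_normal := h.contDiffOn_normal.mono hVU
  injective x hx := h.injective x (hVU hx)
  unit x hx := h.unit x (hVU hx)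
  normal x hx := h.normal x (hVU hx)
  radial x hx := h.radial x (hVU hx)
  parallel x hx := h.parallel x (hVU hx)
  profile x hx := h.profile x (hVU hx)

theorem hasFDerivAt (h : IsRotationalPatch U F G κ₁ κ₂) (hx : x ∈ U) :
    HasFDerivAt F (fderiv ℝ F x) x :=
  ((h.contDiffOn.contDiffAt (h.isOpen.mem_nhds hx)).differentiableAt (by simp)).hasFDerivAt

theorem hasFDerivAt_normal (h : IsRotationalPatch U F G κ₁ κ₂) (hx : x ∈ U) :
    HasFDerivAt G (fderiv ℝ G x) x :=
  ((h.contDiffOn_normal.contDiffAt (h.isOpen.mem_nhds hx)).differentiableAt (by simp)).hasFDerivAt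

theorem hasFDerivAt_coord (h : IsRotationalPatch U F G κ₁ κ₂) (hx : x ∈ U) (i : Fin 3) :
    HasFDerivAt (fun x => F x i) ((EuclideanSpace.proj i).comp (fderiv ℝ F x)) x :=
  (EuclideanSpace.proj (𝕜 := ℝ) i).hasFDerivAt.comp x (h.hasFDerivAt hx)

theorem hasFDerivAt_normal_coord (h : IsRotationalPatch U F G κ₁ κ₂) (hx : x ∈ U) (i : Fin 3) :
    HasFDerivAt (fun x => G x i) ((EuclideanSpace.proj i).comp (fderiv ℝ G x)) x :=
  (EuclideanSpace.proj (𝕜 := ℝ) i).hasFDerivAt.comp x (h.hasFDerivAt_normal hx)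

theorem exists_fderiv_eq (h : IsRotationalPatch U F G κ₁ κ₂) (hx : x ∈ U) (a b c : ℝ)
    (hy : G x 0 * a + G x 1 * b + G x 2 * c = 0) :
    ∃ v, fderiv ℝ F x v 0 = a ∧ fderiv ℝ F x v 1 = b ∧ fderiv ℝ F x v 2 = c := by
  obtain ⟨v, hv⟩ := exists_apply_eq_of_orthogonal (fderiv ℝ F x) (h.injective x hx) (G x) !₂[a, b, c]
    (by
      intro h0
      have := h.unit x hx
      simp [h0] at this)
    (fun v => by
      have := h.normal x hx v
      simp only [PiLp.inner_apply, Fin.sum_univ_three, RCLike.inner_apply, conj_trivial]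
      linarith)
    (by
      simp [PiLp.inner_apply, Fin.sum_univ_three]
      linarith)
  exact ⟨v, by simp [hv]⟩

/-- The vanishing of a derivative of a function which is constant on the patch. -/
theorem hasFDerivAt_apply_eq_zero (h : IsRotationalPatch U F G κ₁ κ₂) (hx : x ∈ U)
    {φ : EuclPlane → ℝ} {φ' : EuclPlane →L[ℝ] ℝ} {c : ℝ} (hφ : ∀ y ∈ U, φ y = c)
    (hd : HasFDerivAt φ φ' x) (v : EuclPlane) : φ' v = 0 := by
  have h1 : φ =ᶠ[nhds x] fun _ => c := by
    filter_upwards [h.isOpen.mem_nhds hx] with y hy using hφ y hy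
  have h2 := hd.unique ((hasFDerivAt_const c x).congr_of_eventuallyEq h1)
  simp [h2]

theorem fderiv_radial (h : IsRotationalPatch U F G κ₁ κ₂) (hx : x ∈ U) (v : EuclPlane) :
    F x 0 * fderiv ℝ G x v 1 + G x 1 * fderiv ℝ F x v 0
      - (F x 1 * fderiv ℝ G x v 0 + G x 0 * fderiv ℝ F x v 1) = 0 := by
  have := h.hasFDerivAt_apply_eq_zero hx h.radial
    (((h.hasFDerivAt_coord hx 0).mul (h.hasFDerivAt_normal_coord hx 1)).sub
      ((h.hasFDerivAt_coord hx 1).mul (h.hasFDerivAt_normal_coord hx 0))) v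
  simpa using this

/-- On the axis, the derivative of the radial identity along the tangent vector `(-G₁, G₀, 0)` is
`-(G₀² + G₁²)`. -/
theorem normal_of_axis (h : IsRotationalPatch U F G κ₁ κ₂) (hx : x ∈ U) (h0 : F x 0 = 0)
    (h1 : F x 1 = 0) : G x 0 = 0 ∧ G x 1 = 0 := by
  obtain ⟨v, hv0, hv1, -⟩ := h.exists_fderiv_eq hx (-G x 1) (G x 0) 0 (by ring)
  have := h.fderiv_radial hx v
  rw [h0, h1, hv0, hv1] at this
  have hs : G x 0 ^ 2 + G x 1 ^ 2 = 0 := by linear_combination -this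
  constructor <;> nlinarith [sq_nonneg (G x 0), sq_nonneg (G x 1)]

/-- Off the axis this comes from differentiating the radial identity along the parallel, where the
shape operator acts as `κ₁`. On the axis both sides vanish. -/
theorem normal_horizontal (h : IsRotationalPatch U F G κ₁ κ₂) (hx : x ∈ U) :
    G x 0 = -κ₁ x * F x 0 ∧ G x 1 = -κ₁ x * F x 1 := by
  by_cases hax : F x 0 ^ 2 + F x 1 ^ 2 = 0
  · have h0 : F x 0 = 0 := by nlinarith [sq_nonneg (F x 0), sq_nonneg (F x 1)]
    have h1 : F x 1 = 0 := by nlinarith [sq_nonneg (F x 0), sq_nonneg (F x 1)]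
    simp [h.normal_of_axis hx h0 h1, h0, h1]
  obtain ⟨v, hv0, hv1, hv2⟩ := h.exists_fderiv_eq hx (-F x 1) (F x 0) 0
    (by linarith [h.radial x hx])
  have hp := h.parallel x hx v hv2 (by rw [hv0, hv1]; ring)
  have hp0 : -(fderiv ℝ G x v 0) = κ₁ x * fderiv ℝ F x v 0 := congrArg (fun w => w 0) hp
  have hp1 : -(fderiv ℝ G x v 1) = κ₁ x * fderiv ℝ F x v 1 := congrArg (fun w => w 1) hp
  have hr := h.fderiv_radial hx v
  have hr' := h.radial x hx
  have e0 : fderiv ℝ G x v 0 = κ₁ x * F x 1 := by rw [hv0] at hp0; linarith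
  have e1 : fderiv ℝ G x v 1 = -κ₁ x * F x 0 := by rw [hv1] at hp1; linarith
  rw [hv0, hv1, e0, e1] at hr
  constructor <;> apply mul_left_cancel₀ hax
  · linear_combination -F x 0 * hr - F x 1 * hr'
  · linear_combination -F x 1 * hr + F x 0 * hr'

/-- Tangent vectors split into a parallel and a profile part. -/
theorem exists_decomposition (h : IsRotationalPatch U F G κ₁ κ₂) (hx : x ∈ U) (v : EuclPlane) :
    ∃ (l : ℝ) (τ : EuclSpace), F x 0 * τ 1 - F x 1 * τ 0 = 0 ∧
      fderiv ℝ F x v 0 = -(l * F x 1) + τ 0 ∧ fderiv ℝ F x v 1 = l * F x 0 + τ 1 ∧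
      fderiv ℝ F x v 2 = τ 2 ∧
      fderiv ℝ G x v 0 = κ₁ x * l * F x 1 - κ₂ x * τ 0 ∧
      fderiv ℝ G x v 1 = -(κ₁ x * l * F x 0) - κ₂ x * τ 1 ∧
      fderiv ℝ G x v 2 = -(κ₂ x * τ 2) := by
  have key : ∃ (l : ℝ) (u : EuclPlane), fderiv ℝ F x u 0 = -(l * F x 1) ∧
      fderiv ℝ F x u 1 = l * F x 0 ∧ fderiv ℝ F x u 2 = 0 ∧
      F x 0 * fderiv ℝ F x (v - u) 1 - F x 1 * fderiv ℝ F x (v - u) 0 = 0 := by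
    by_cases hax : F x 0 ^ 2 + F x 1 ^ 2 = 0
    · have h0 : F x 0 = 0 := by nlinarith [sq_nonneg (F x 0), sq_nonneg (F x 1)]
      have h1 : F x 1 = 0 := by nlinarith [sq_nonneg (F x 0), sq_nonneg (F x 1)]
      exact ⟨0, 0, by simp [h0, h1]⟩
    -- Off the axis, `l` is the angular velocity of the tangent vector about the axis.
    · obtain ⟨u, h0, h1, h2⟩ := h.exists_fderiv_eq hx
        (-((F x 0 * fderiv ℝ F x v 1 - F x 1 * fderiv ℝ F x v 0) / (F x 0 ^ 2 + F x 1 ^ 2) * F x 1))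
        ((F x 0 * fderiv ℝ F x v 1 - F x 1 * fderiv ℝ F x v 0) / (F x 0 ^ 2 + F x 1 ^ 2) * F x 0) 0
        (by linear_combination (F x 0 * fderiv ℝ F x v 1 - F x 1 * fderiv ℝ F x v 0) /
              (F x 0 ^ 2 + F x 1 ^ 2) * h.radial x hx)
      refine ⟨_, u, h0, h1, h2, ?_⟩
      rw [map_sub, PiLp.sub_apply, PiLp.sub_apply, h0, h1]
      field_simp
      ring
  obtain ⟨l, u, h0, h1, h2, h3⟩ := key
  have hp := h.parallel x hx u h2 (by rw [h0, h1]; ring)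
  have hq := h.profile x hx (v - u) h3
  have hp' (i : Fin 3) : -(fderiv ℝ G x u i) = κ₁ x * fderiv ℝ F x u i :=
    congrArg (fun w => w i) hp
  have hq' (i : Fin 3) : -(fderiv ℝ G x v i - fderiv ℝ G x u i)
      = κ₂ x * fderiv ℝ F x (v - u) i := by
    have := congrArg (fun w => w i) hq
    simpa only [map_sub, PiLp.neg_apply, PiLp.sub_apply, PiLp.smul_apply, smul_eq_mul] using this
  have hs (i : Fin 3) : fderiv ℝ F x (v - u) i = fderiv ℝ F x v i - fderiv ℝ F x u i := by
    rw [map_sub]; rfl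
  refine ⟨l, fderiv ℝ F x (v - u), h3, ?_, ?_, ?_, ?_, ?_, ?_⟩
  · linarith [hs 0]
  · linarith [hs 1]
  · linarith [hs 2]
  · have := hp' 0; have := hq' 0; rw [h0] at *; linarith
  · have := hp' 1; have := hq' 1; rw [h1] at *; linarith
  · have := hp' 2; have := hq' 2; rw [h2] at *; linarith

/-! ### Continuity of the profile curvature -/

theorem continuousAt_fderiv (h : IsRotationalPatch U F G κ₁ κ₂) (hx : x ∈ U) :
    ContinuousAt (fderiv ℝ F) x :=
  (h.contDiffOn.continuousOn_fderiv_of_isOpen h.isOpen le_rfl).continuousAt (h.isOpen.mem_nhds hx)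

theorem continuousAt_fderiv_normal (h : IsRotationalPatch U F G κ₁ κ₂) (hx : x ∈ U) :
    ContinuousAt (fderiv ℝ G) x :=
  (h.contDiffOn_normal.continuousOn_fderiv_of_isOpen h.isOpen le_rfl).continuousAt
    (h.isOpen.mem_nhds hx)

/-- There are profile directions at every point. -/
theorem exists_profile (F : EuclPlane → EuclSpace) (x : EuclPlane) :
    ∃ v ≠ 0, F x 0 * fderiv ℝ F x v 1 - F x 1 * fderiv ℝ F x v 0 = 0 := by
  let φ : EuclPlane →ₗ[ℝ] ℝ := (F x 0 • (EuclideanSpace.proj (1 : Fin 3) : EuclSpace →L[ℝ] ℝ)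
    - F x 1 • (EuclideanSpace.proj (0 : Fin 3) : EuclSpace →L[ℝ] ℝ)).comp (fderiv ℝ F x)
  have : LinearMap.ker φ ≠ ⊥ := LinearMap.ker_ne_bot_of_finrank_lt (by simp)
  obtain ⟨v, hv, hv0⟩ := (Submodule.ne_bot_iff _).1 this
  exact ⟨v, hv0, by simpa [φ] using hv⟩

/-- On the axis every direction is a profile direction, so `dG = -κ₂ dF` on the whole tangent plane
there. At a nearby `y`, a profile vector `v` satisfies `(κ₂ x - κ₂ y) dF_y v = (dG_y + κ₂ x dF_y)
v`. The right side is small relative to `v`, and `dF_y v` is bounded below because `dF_x` is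
injective. -/
theorem continuousAt_of_axis (h : IsRotationalPatch U F G κ₁ κ₂) (hx : x ∈ U)
    (h0 : F x 0 = 0) (h1 : F x 1 = 0) : ContinuousAt κ₂ x := by
  obtain ⟨C, hC0, hC⟩ := (fderiv ℝ F x).exists_antilipschitzWith
    (LinearMap.ker_eq_bot.2 (h.injective x hx))
  have hC1 : ∀ v, ‖v‖ ≤ C * ‖fderiv ℝ F x v‖ := fun v => by
    simpa using hC.le_mul_norm (map_zero _) v
  have hS : ∀ v, fderiv ℝ G x v + κ₂ x • fderiv ℝ F x v = 0 := fun v => by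
    rw [← h.profile x hx v (by simp [h0, h1])]; simp
  rw [Metric.continuousAt_iff']
  intro ε hε
  have hCpos : (0 : ℝ) < C := hC0
  have c1 : Filter.Tendsto (fun y => ‖fderiv ℝ F y - fderiv ℝ F x‖) (nhds x) (nhds 0) := by
    simpa using ((h.continuousAt_fderiv hx).sub
      (continuousAt_const (y := fderiv ℝ F x))).norm.tendsto
  have c2 : Filter.Tendsto (fun y => ‖fderiv ℝ G y + κ₂ x • fderiv ℝ F y‖) (nhds x) (nhds 0) := by
    have : fderiv ℝ G x + κ₂ x • fderiv ℝ F x = 0 := by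
      ext1 v; exact hS v
    have h3 := ((h.continuousAt_fderiv_normal hx).add
      (((h.continuousAt_fderiv hx).const_smul (κ₂ x)))).norm.tendsto
    simpa [this] using h3
  filter_upwards [h.isOpen.mem_nhds hx,
    c1.eventually (gt_mem_nhds (show 0 < 1 / (2 * (C : ℝ)) by positivity)),
    c2.eventually (gt_mem_nhds (show 0 < ε / (2 * (C : ℝ)) by positivity))] with y hy hy1 hy2
  obtain ⟨v, hv0, hv⟩ := exists_profile F y
  have hp := h.profile y hy v hv
  have e1 : (fderiv ℝ G y + κ₂ x • fderiv ℝ F y) v = (κ₂ x - κ₂ y) • fderiv ℝ F y v := by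
    have : fderiv ℝ G y v = -(κ₂ y • fderiv ℝ F y v) := by rw [← hp]; simp
    simp only [add_apply, smul_apply, this, sub_smul]
    abel
  have e2 := (fderiv ℝ G y + κ₂ x • fderiv ℝ F y).le_opNorm v
  rw [e1, norm_smul] at e2
  have e3 := (fderiv ℝ F y - fderiv ℝ F x).le_opNorm v
  have e4 : ‖fderiv ℝ F x v‖ ≤ ‖fderiv ℝ F y v‖ + ‖(fderiv ℝ F y - fderiv ℝ F x) v‖ := by
    rw [sub_apply, norm_sub_rev]
    have := norm_add_le (fderiv ℝ F y v) (fderiv ℝ F x v - fderiv ℝ F y v)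
    simpa using this
  have hvpos : 0 < ‖v‖ := norm_pos_iff.2 hv0
  have e5 := hC1 v
  rw [lt_div_iff₀ (by positivity)] at hy1 hy2
  rw [dist_comm, Real.dist_eq, ← Real.norm_eq_abs]
  -- The lower bound for `dF_x` passes to `dF_y` with its constant doubled, since `dF_y` is within
  -- `1 / (2C)` of `dF_x`.
  have e6 : ‖v‖ ≤ 2 * C * ‖fderiv ℝ F y v‖ := by
    have : C * ‖(fderiv ℝ F y - fderiv ℝ F x) v‖ ≤ ‖v‖ / 2 := by
      calc _ ≤ C * (‖fderiv ℝ F y - fderiv ℝ F x‖ * ‖v‖) := by gcongr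
        _ = (‖fderiv ℝ F y - fderiv ℝ F x‖ * (2 * C)) * ‖v‖ / 2 := by ring
        _ ≤ 1 * ‖v‖ / 2 := by gcongr
        _ = _ := by ring
    nlinarith
  have e7 : 0 < 2 * C * ‖fderiv ℝ F y v‖ := hvpos.trans_le e6
  have e8 : 0 < ‖fderiv ℝ F y v‖ := by
    by_contra hneg
    nlinarith [norm_nonneg (fderiv ℝ F y v)]
  have e9 : ‖κ₂ x - κ₂ y‖ * ‖fderiv ℝ F y v‖ < ε * ‖fderiv ℝ F y v‖ := by
    calc _ ≤ ‖fderiv ℝ G y + κ₂ x • fderiv ℝ F y‖ * ‖v‖ := e2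
      _ ≤ ‖fderiv ℝ G y + κ₂ x • fderiv ℝ F y‖ * (2 * C * ‖fderiv ℝ F y v‖) := by gcongr
      _ = (‖fderiv ℝ G y + κ₂ x • fderiv ℝ F y‖ * (2 * C)) * ‖fderiv ℝ F y v‖ := by ring
      _ < _ := by gcongr
  exact lt_of_mul_lt_mul_right e9 e8.le

/-- Pairing with the profile direction `w × G`, where `w` is tangent to the parallel, extracts the
curvature of the profile curves. -/
theorem inner_profile (h : IsRotationalPatch U F G κ₁ κ₂) (hx : x ∈ U) (v : EuclPlane) :
    F x 0 * G x 2 * fderiv ℝ G x v 0 + F x 1 * G x 2 * fderiv ℝ G x v 1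
        - (F x 0 * G x 0 + F x 1 * G x 1) * fderiv ℝ G x v 2
      = -κ₂ x * (F x 0 * G x 2 * fderiv ℝ F x v 0 + F x 1 * G x 2 * fderiv ℝ F x v 1
        - (F x 0 * G x 0 + F x 1 * G x 1) * fderiv ℝ F x v 2) := by
  obtain ⟨l, τ, -, h0, h1, h2, g0, g1, g2⟩ := h.exists_decomposition hx v
  rw [h0, h1, h2, g0, g1, g2]
  ring

/-- With `v` fixed, `inner_profile` exhibits `κ₂` near `x` as a quotient of continuous functions.
The choice of `v` as the profile direction at `x` makes the denominator there the squared distance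
from the axis. -/
theorem continuousAt_of_not_axis (h : IsRotationalPatch U F G κ₁ κ₂) (hx : x ∈ U)
    (hax : F x 0 ^ 2 + F x 1 ^ 2 ≠ 0) : ContinuousAt κ₂ x := by
  obtain ⟨v, hv0, hv1, hv2⟩ := h.exists_fderiv_eq hx (F x 0 * G x 2) (F x 1 * G x 2)
    (-(F x 0 * G x 0 + F x 1 * G x 1)) (by ring)
  have cF (i : Fin 3) : ContinuousAt (fun y => F y i) x := (h.hasFDerivAt_coord hx i).continuousAt
  have cG (i : Fin 3) : ContinuousAt (fun y => G y i) x :=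
    (h.hasFDerivAt_normal_coord hx i).continuousAt
  have cF' (i : Fin 3) : ContinuousAt (fun y => fderiv ℝ F y v i) x := by
    have : ContinuousAt (fun y => fderiv ℝ F y v) x :=
      (h.continuousAt_fderiv hx).clm_apply continuousAt_const
    exact (EuclideanSpace.proj (𝕜 := ℝ) i).continuous.continuousAt.comp this
  have cG' (i : Fin 3) : ContinuousAt (fun y => fderiv ℝ G y v i) x := by
    have : ContinuousAt (fun y => fderiv ℝ G y v) x :=
      (h.continuousAt_fderiv_normal hx).clm_apply continuousAt_const
    exact (EuclideanSpace.proj (𝕜 := ℝ) i).continuous.continuousAt.comp this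
  set num : EuclPlane → ℝ := fun x =>
    F x 0 * G x 2 * fderiv ℝ G x v 0 + F x 1 * G x 2 * fderiv ℝ G x v 1
        - (F x 0 * G x 0 + F x 1 * G x 1) * fderiv ℝ G x v 2 with hnum
  set den : EuclPlane → ℝ := fun x =>
    F x 0 * G x 2 * fderiv ℝ F x v 0 + F x 1 * G x 2 * fderiv ℝ F x v 1
        - (F x 0 * G x 0 + F x 1 * G x 1) * fderiv ℝ F x v 2 with hden
  have cnum : ContinuousAt num x :=
    ((((cF 0).mul (cG 2)).mul (cG' 0)).add (((cF 1).mul (cG 2)).mul (cG' 1))).sub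
      ((((cF 0).mul (cG 0)).add ((cF 1).mul (cG 1))).mul (cG' 2))
  have cden : ContinuousAt den x :=
    ((((cF 0).mul (cG 2)).mul (cF' 0)).add (((cF 1).mul (cG 2)).mul (cF' 1))).sub
      ((((cF 0).mul (cG 0)).add ((cF 1).mul (cG 1))).mul (cF' 2))
  have hd : den x ≠ 0 := by
    have : den x = F x 0 ^ 2 + F x 1 ^ 2 := by
      simp only [hden, hv0, hv1, hv2]
      linear_combination (F x 0 ^ 2 + F x 1 ^ 2) * h.unit x hx
        - (F x 0 * G x 1 - F x 1 * G x 0) * h.radial x hx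
    rwa [this]
  refine ((cnum.neg).div cden hd).congr ?_
  filter_upwards [h.isOpen.mem_nhds hx, cden.eventually_ne hd] with y hy hdy
  have := h.inner_profile hy v
  show -num y / den y = κ₂ y
  rw [div_eq_iff hdy]
  linarith

theorem continuousAt (h : IsRotationalPatch U F G κ₁ κ₂) (hx : x ∈ U) : ContinuousAt κ₂ x := by
  by_cases hax : F x 0 ^ 2 + F x 1 ^ 2 = 0
  · exact h.continuousAt_of_axis hx (by nlinarith [sq_nonneg (F x 0), sq_nonneg (F x 1)])
      (by nlinarith [sq_nonneg (F x 0), sq_nonneg (F x 1)])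
  · exact h.continuousAt_of_not_axis hx hax

/-! ### Rigidity where the parallel curvature is constant -/

/-- If the curvature of the parallels is constant, then the curvature of the profile curves either
agrees with it or vanishes. -/
theorem eq_or_eq_zero_of_const (h : IsRotationalPatch U F G κ₁ κ₂) {a : ℝ}
    (ha : ∀ y ∈ U, κ₁ y = a) (hx : x ∈ U) : κ₂ x = a ∨ κ₂ x = 0 := by
  by_contra! hne
  have hco : ContinuousOn κ₂ U := fun y hy => (h.continuousAt hy).continuousWithinAt
  have hV := hco.isOpen_inter_preimage h.isOpen (isOpen_compl_singleton (x := a))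
  have hP := h.mono hV Set.inter_subset_left
  -- Along a profile direction, `dG_i = -a dF_i` by differentiating `G_i = -a F_i`, while `dG_i =
  -- -κ₂ dF_i` by definition. Since `κ₂ ≠ a` on this open set, profile directions have no horizontal
  -- component.
  have hh (i : Fin 3) (hi : ∀ y ∈ U, G y i = -κ₁ y * F y i) (y : EuclPlane)
      (hy : y ∈ U ∩ κ₂ ⁻¹' {a}ᶜ) (v : EuclPlane)
      (hv : F y 0 * fderiv ℝ F y v 1 - F y 1 * fderiv ℝ F y v 0 = 0) : fderiv ℝ F y v i = 0 := by
    have e1 := hP.hasFDerivAt_apply_eq_zero hy (c := 0)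
      (φ := fun y => G y i + a * F y i) (fun z hz => by
        rw [hi z hz.1, ha z hz.1]; ring)
      ((hP.hasFDerivAt_normal_coord hy i).add ((hP.hasFDerivAt_coord hy i).const_mul a)) v
    have e2 : -(fderiv ℝ G y v i) = κ₂ y * fderiv ℝ F y v i :=
      congrArg (fun w => w i) (hP.profile y hy v hv)
    have e3 : fderiv ℝ G y v i + a * fderiv ℝ F y v i = 0 := by simpa using e1
    have e4 : (a - κ₂ y) * fderiv ℝ F y v i = 0 := by linear_combination e2 + e3
    rcases mul_eq_zero.1 e4 with h5 | h5
    · exact absurd (show κ₂ y = a by linarith) hy.2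
    · exact h5
  have hh0 := hh 0 (fun y hy => (h.normal_horizontal hy).1)
  have hh1 := hh 1 (fun y hy => (h.normal_horizontal hy).2)
  have hh2 (y : EuclPlane) (hy : y ∈ U ∩ κ₂ ⁻¹' {a}ᶜ) (v : EuclPlane) (hv0 : v ≠ 0)
      (hv : F y 0 * fderiv ℝ F y v 1 - F y 1 * fderiv ℝ F y v 0 = 0) : fderiv ℝ F y v 2 ≠ 0 := by
    intro h2
    apply hv0
    apply hP.injective y hy
    rw [map_zero]
    ext i
    fin_cases i
    · exact hh0 y hy v hv
    · exact hh1 y hy v hv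
    · exact h2
  -- Profile directions are vertical, so the normal is horizontal on an open set and `G₂` may be
  -- differentiated there.
  have hG : ∀ y ∈ U ∩ κ₂ ⁻¹' {a}ᶜ, G y 2 = 0 := by
    intro y hy
    obtain ⟨v, hv0, hv⟩ := exists_profile F y
    have hn := hP.normal y hy v
    rw [hh0 y hy v hv, hh1 y hy v hv] at hn
    have : G y 2 * fderiv ℝ F y v 2 = 0 := by linarith
    exact (mul_eq_zero.1 this).resolve_right (hh2 y hy v hv0 hv)
  have hxV : x ∈ U ∩ κ₂ ⁻¹' {a}ᶜ := ⟨hx, hne.1⟩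
  obtain ⟨v, hv0, hv⟩ := exists_profile F x
  have e1 : fderiv ℝ G x v 2 = 0 := by
    simpa using hP.hasFDerivAt_apply_eq_zero hxV hG (hP.hasFDerivAt_normal_coord hxV 2) v
  have e2 : -(fderiv ℝ G x v 2) = κ₂ x * fderiv ℝ F x v 2 :=
    congrArg (fun w => w 2) (hP.profile x hxV v hv)
  rw [e1, neg_zero, eq_comm] at e2
  exact (mul_eq_zero.1 e2).elim hne.2 (hh2 x hxV v hv0 hv)

/-! ### Conserved quantities when the profile curvature is constant -/

/-- The distance from the axis of the centre of curvature of the profile curve is stationary. -/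
theorem hasFDerivAt_centre_dist (h : IsRotationalPatch U F G κ₁ κ₂) {r : ℝ}
    (hb : ∀ y ∈ U, r * κ₂ y = 1) (hx : x ∈ U) :
    HasFDerivAt (fun y => (F y 0 + r * G y 0) * (F y 0 + r * G y 0)
      + (F y 1 + r * G y 1) * (F y 1 + r * G y 1)) (0 : EuclPlane →L[ℝ] ℝ) x := by
  have d (i : Fin 3) :=
    (h.hasFDerivAt_coord hx i).add ((h.hasFDerivAt_normal_coord hx i).const_mul r)
  refine (((d 0).mul (d 0)).add ((d 1).mul (d 1))).congr_fderiv ?_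
  ext1 v
  obtain ⟨l, τ, ht, h0, h1, h2, g0, g1, g2⟩ := h.exists_decomposition hx v
  have hr := hb x hx
  have hG := h.radial x hx
  simp [h0, h1, g0, g1]
  -- The profile part `τ` is killed by `r κ₂ = 1`; the parallel part, proportional to `l`, is killed
  -- by the radial identity.
  linear_combination (-2 * (F x 0 + r * G x 0) * τ 0 - 2 * (F x 1 + r * G x 1) * τ 1) * hr
    + 2 * r * l * (1 - r * κ₁ x) * hG

/-- The height of the centre of curvature of the profile curve is stationary. -/
theorem hasFDerivAt_centre_height (h : IsRotationalPatch U F G κ₁ κ₂) {r : ℝ}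
    (hb : ∀ y ∈ U, r * κ₂ y = 1) (hx : x ∈ U) :
    HasFDerivAt (fun y => F y 2 + r * G y 2) (0 : EuclPlane →L[ℝ] ℝ) x := by
  refine ((h.hasFDerivAt_coord hx 2).add
    ((h.hasFDerivAt_normal_coord hx 2).const_mul r)).congr_fderiv ?_
  ext1 v
  obtain ⟨l, τ, ht, h0, h1, h2, g0, g1, g2⟩ := h.exists_decomposition hx v
  have hr := hb x hx
  simp [h2, g2]
  linear_combination -τ 2 * hr

/-- If the profile curves are straight, then the slope of the normal is stationary. -/
theorem hasFDerivAt_normal_height (h : IsRotationalPatch U F G κ₁ κ₂)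
    (hb : ∀ y ∈ U, κ₂ y = 0) (hx : x ∈ U) :
    HasFDerivAt (fun y => G y 2) (0 : EuclPlane →L[ℝ] ℝ) x := by
  refine (h.hasFDerivAt_normal_coord hx 2).congr_fderiv ?_
  ext1 v
  obtain ⟨l, τ, ht, h0, h1, h2, g0, g1, g2⟩ := h.exists_decomposition hx v
  simp [g2, hb x hx]

/-- If the profile curves are straight, then the support function is stationary. -/
theorem hasFDerivAt_support (h : IsRotationalPatch U F G κ₁ κ₂)
    (hb : ∀ y ∈ U, κ₂ y = 0) (hx : x ∈ U) :
    HasFDerivAt (fun y => F y 0 * G y 0 + F y 1 * G y 1 + F y 2 * G y 2)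
      (0 : EuclPlane →L[ℝ] ℝ) x := by
  have d (i : Fin 3) := (h.hasFDerivAt_coord hx i).mul (h.hasFDerivAt_normal_coord hx i)
  refine (((d 0).add (d 1)).add (d 2)).congr_fderiv ?_
  ext1 v
  obtain ⟨l, τ, ht, h0, h1, h2, g0, g1, g2⟩ := h.exists_decomposition hx v
  have hn := h.normal x hx v
  have hb' := hb x hx
  simp [g0, g1, g2, hb']
  linear_combination hn

end IsRotationalPatch

/-! ### Tangency of rotation orbits -/

open Topology Filter Asymptotics in
/-- If a differentiable curve lies on the image of an immersion and lifts continuously, then its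
velocity is tangent. -/
theorem inner_deriv_eq_zero_of_lift {F : EuclPlane → EuclSpace} {x : EuclPlane}
    {F' : EuclPlane →L[ℝ] EuclSpace} (hF : HasFDerivAt F F' x) (hinj : Function.Injective F')
    {n : EuclSpace} (hn : ∀ v, inner ℝ n (F' v) = 0) {u : ℝ → EuclPlane}
    (hu : Tendsto u (𝓝 0) (𝓝 x)) {γ : ℝ → EuclSpace} {γ' : EuclSpace} (hγ : HasDerivAt γ γ' 0)
    (hγ0 : γ 0 = F x) (hγu : ∀ᶠ t in 𝓝 0, F (u t) = γ t) : inner ℝ n γ' = 0 := by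
  have hC := LinearMap.isClosedEmbedding_of_injective (f := F'.toLinearMap)
    (LinearMap.ker_eq_bot.2 hinj)
  -- An injective differential makes `y - x` comparable to `F y - F x`. The error is thus small
  -- relative to the displacement in space, and continuity of the lift `u` suffices.
  have h1 : (fun y => F y - F x - F' (y - x)) =o[𝓝 x] fun y => F y - F x :=
    hF.isLittleO.trans_isBigO (hF.isTheta_sub hC.toIsInducing).symm.1
  have h2 : (fun y => inner ℝ n (F y - F x)) =o[𝓝 x] fun y => F y - F x := by
    refine IsBigO.trans_isLittleO (IsBigO.of_bound ‖n‖ (Eventually.of_forall fun y => ?_)) h1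
    have : inner ℝ n (F y - F x) = inner ℝ n (F y - F x - F' (y - x)) := by
      rw [inner_sub_right _ _ (F' _), hn, sub_zero]
    rw [this]
    exact norm_inner_le_norm _ _
  have h3 : (fun t => inner ℝ n (γ t - γ 0)) =o[𝓝 0] fun t : ℝ => t - 0 := by
    refine IsLittleO.trans_isBigO ?_ hγ.differentiableAt.isBigO_sub
    refine (h2.comp_tendsto hu).congr' ?_ ?_ <;>
    · filter_upwards [hγu] with t ht
      simp [ht, hγ0]
  have h4 : HasDerivAt (fun t => inner ℝ n (γ t)) 0 0 := by
    rw [hasDerivAt_iff_isLittleO]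
    simpa [inner_sub_right] using h3
  have h5 : HasDerivAt (fun t => inner ℝ n (γ t)) (inner ℝ n γ') 0 := by
    simpa using (hasDerivAt_const (0 : ℝ) n).inner ℝ hγ
  exact h5.unique h4

theorem hasDerivAt_rotateZ (y : EuclSpace) :
    HasDerivAt (fun t => rotateZ t y) !₂[-y 1, y 0, 0] 0 := by
  have h : (fun t => rotateZ t y) = fun t => Real.cos t • (!₂[y 0, y 1, 0] : EuclSpace)
      + Real.sin t • (!₂[-y 1, y 0, 0] : EuclSpace) + !₂[0, 0, y 2] := by
    funext t
    ext i
    fin_cases i <;> simp [rotateZ] <;> ring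
  rw [h]
  have := (((Real.hasDerivAt_cos 0).smul_const (!₂[y 0, y 1, 0] : EuclSpace)).add
    ((Real.hasDerivAt_sin 0).smul_const (!₂[-y 1, y 0, 0] : EuclSpace))).add_const
      (!₂[0, 0, y 2] : EuclSpace)
  simpa using this

theorem AffineIsometryEquiv.apply_eq_linear_add (A : EuclSpace ≃ᵃⁱ[ℝ] EuclSpace) (x : EuclSpace) :
    A x = A.linearIsometryEquiv x + A 0 := by
  simpa using A.map_vadd 0 x

theorem AffineIsometryEquiv.linear_sub (A : EuclSpace ≃ᵃⁱ[ℝ] EuclSpace) (x y : EuclSpace) :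
    A.linearIsometryEquiv (x - y) = A x - A y := by
  rw [A.apply_eq_linear_add x, A.apply_eq_linear_add y, map_sub]
  abel

theorem EuclSpace.norm_sq_eq (x : EuclSpace) : ‖x‖ ^ 2 = x 0 ^ 2 + x 1 ^ 2 + x 2 ^ 2 := by
  simp [EuclideanSpace.norm_sq_eq, Fin.sum_univ_three]

/-! ### Axis distance and height in adapted coordinates -/

section Axis

variable (A : EuclSpace ≃ᵃⁱ[ℝ] EuclSpace) (z ε : ℝ)

/-- The sign `ε = ±1` orients the axis, so that a one-sided cone can open either way. -/
theorem axisHeight_frame (x : EuclSpace) :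
    axisHeight (A.symm !₂[0, 0, z]) (A.linearIsometryEquiv.symm !₂[0, 0, ε]) x
      = ε * (A x 2 - z) := by
  rw [axisHeight, ← A.linearIsometryEquiv.inner_map_map, A.linear_sub]
  simp [PiLp.inner_apply, Fin.sum_univ_three]
  ring

theorem norm_frame (hε : ε ^ 2 = 1) :
    ‖A.linearIsometryEquiv.symm (!₂[0, 0, ε] : EuclSpace)‖ = 1 := by
  rw [LinearIsometryEquiv.norm_map, ← sq_eq_sq₀ (norm_nonneg _) zero_le_one, EuclSpace.norm_sq_eq]
  simpa using hε

theorem axisDist_frame (hε : ε ^ 2 = 1) (x : EuclSpace) :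
    axisDist (A.symm !₂[0, 0, z]) (A.linearIsometryEquiv.symm !₂[0, 0, ε]) x
      = √(A x 0 ^ 2 + A x 1 ^ 2) := by
  rw [axisDist, axisHeight_frame, ← A.linearIsometryEquiv.norm_map, map_sub, map_smul,
    A.linear_sub, eq_comm, Real.sqrt_eq_iff_mul_self_eq (by positivity) (norm_nonneg _), ← sq,
    EuclSpace.norm_sq_eq]
  simp
  linear_combination -(A x 2 - z) * hε

end Axis

/-! ### Passage from the surface to its charts -/

section Surfaces

variable {M : Type*} [TopologicalSpace M] [ChartedSpace EuclPlane M]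

theorem fderiv_comp_chart_symm [IsManifold 𝓘(ℝ, EuclPlane) 2 M] {f : M → EuclSpace}
    (hf : ContMDiff 𝓘(ℝ, EuclPlane) 𝓘(ℝ, EuclSpace) 1 f) (p : M) {x : EuclPlane}
    (hx : x ∈ (chartAt EuclPlane p).target) (v : EuclPlane) :
    fderiv ℝ (fun x => f ((chartAt EuclPlane p).symm x)) x v
      = surfDiff f ((chartAt EuclPlane p).symm x)
        (mfderiv 𝓘(ℝ, EuclPlane) 𝓘(ℝ, EuclPlane) (chartAt EuclPlane p).symm x v) := by
  have : IsManifold 𝓘(ℝ, EuclPlane) 1 M := .of_le one_le_two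
  rw [← mfderiv_eq_fderiv]
  have h1 := mfderiv_comp (I := 𝓘(ℝ, EuclPlane)) (I' := 𝓘(ℝ, EuclPlane)) (I'' := 𝓘(ℝ, EuclSpace)) x
    (hf.mdifferentiable (by simp) _) (mdifferentiableAt_atlas_symm (chart_mem_atlas _ p) hx)
  exact congrArg (fun L => L v) h1

theorem normal_unit {f N : M → EuclSpace} (A : EuclSpace ≃ᵃⁱ[ℝ] EuclSpace) (hN : IsUnitNormalField f N) (p : M) :
    A.linearIsometryEquiv (N p) 0 ^ 2 + A.linearIsometryEquiv (N p) 1 ^ 2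
      + A.linearIsometryEquiv (N p) 2 ^ 2 = 1 := by
  rw [← EuclSpace.norm_sq_eq, LinearIsometryEquiv.norm_map, hN.norm_eq_one, one_pow]

theorem isRotationalPatch_chart [IsManifold 𝓘(ℝ, EuclPlane) 2 M]
    {A : EuclSpace ≃ᵃⁱ[ℝ] EuclSpace} {f N : M → EuclSpace} {k₁ k₂ : M → ℝ}
    (hf : IsC2ImmersedSurface f) (hsymm : IsRotationallySymmetric A f)
    (hN : IsUnitNormalField f N) (hk : ArePrincipalCurvatures A f N k₁ k₂) (p : M) :
    IsRotationalPatch (chartAt EuclPlane p).target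
      (fun x => A (f ((chartAt EuclPlane p).symm x)))
      (fun x => A.linearIsometryEquiv (N ((chartAt EuclPlane p).symm x)))
      (fun x => k₁ ((chartAt EuclPlane p).symm x)) (fun x => k₂ ((chartAt EuclPlane p).symm x)) := by
  have : IsManifold 𝓘(ℝ, EuclPlane) 1 M := .of_le one_le_two
  set φ := chartAt EuclPlane p with hφ
  have hf1 : ContMDiff 𝓘(ℝ, EuclPlane) 𝓘(ℝ, EuclSpace) 1 f := hf.contMDiff.of_le one_le_two
  have hψ : ContMDiffOn 𝓘(ℝ, EuclPlane) 𝓘(ℝ, EuclPlane) 1 φ.symm φ.target :=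
    contMDiffOn_chart_symm
  have cf : ContDiffOn ℝ 1 (fun x => f (φ.symm x)) φ.target :=
    contMDiffOn_iff_contDiffOn.1 (hf1.comp_contMDiffOn hψ)
  have cN : ContDiffOn ℝ 1 (fun x => N (φ.symm x)) φ.target :=
    contMDiffOn_iff_contDiffOn.1 (hN.contMDiff.comp_contMDiffOn hψ)
  have hAF : (fun x => A (f (φ.symm x))) = fun x => A.linearIsometryEquiv (f (φ.symm x)) + A 0 :=
    funext fun x => A.apply_eq_linear_add _
  have dF (x : EuclPlane) (hx : x ∈ φ.target) (v : EuclPlane) :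
      fderiv ℝ (fun x => A (f (φ.symm x))) x v = A.linearIsometryEquiv
        (surfDiff f (φ.symm x) (mfderiv 𝓘(ℝ, EuclPlane) 𝓘(ℝ, EuclPlane) φ.symm x v)) := by
    have h1 := ((cf.contDiffAt (φ.open_target.mem_nhds hx)).differentiableAt (by simp)).hasFDerivAt
    have h2 := (A.linearIsometryEquiv.toContinuousLinearEquiv.hasFDerivAt.comp x h1).add_const (A 0)
    rw [← fderiv_comp_chart_symm hf1 p hx, hAF]
    exact congrArg (fun L => L v) h2.fderiv
  have dG (x : EuclPlane) (hx : x ∈ φ.target) (v : EuclPlane) :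
      fderiv ℝ (fun x => A.linearIsometryEquiv (N (φ.symm x))) x v = A.linearIsometryEquiv
        (surfDiff N (φ.symm x) (mfderiv 𝓘(ℝ, EuclPlane) 𝓘(ℝ, EuclPlane) φ.symm x v)) := by
    have h1 := ((cN.contDiffAt (φ.open_target.mem_nhds hx)).differentiableAt (by simp)).hasFDerivAt
    have h2 := A.linearIsometryEquiv.toContinuousLinearEquiv.hasFDerivAt.comp x h1
    rw [← fderiv_comp_chart_symm hN.contMDiff p hx]
    exact congrArg (fun L => L v) h2.fderiv
  have cF : ContDiffOn ℝ 1 (fun x => A (f (φ.symm x))) φ.target := by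
    rw [hAF]
    exact (A.linearIsometryEquiv.toContinuousLinearEquiv.contDiff.comp_contDiffOn cf).add
      contDiffOn_const
  have hinj (x : EuclPlane) (hx : x ∈ φ.target) :
      Function.Injective (fderiv ℝ (fun x => A (f (φ.symm x))) x) := by
    intro v w hvw
    rw [dF x hx, dF x hx] at hvw
    exact (mdifferentiable_chart (I := 𝓘(ℝ, EuclPlane)) p).symm.mfderiv_injective hx
      (hf.injective_diff _ (A.linearIsometryEquiv.injective hvw))
  have hnormal (x : EuclPlane) (hx : x ∈ φ.target) (v : EuclPlane) :
      inner ℝ (A.linearIsometryEquiv (N (φ.symm x)))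
        (fderiv ℝ (fun x => A (f (φ.symm x))) x v) = 0 := by
    rw [dF x hx, LinearIsometryEquiv.inner_map_map]
    exact hN.normal _ _
  refine ⟨φ.open_target, cF, A.linearIsometryEquiv.toContinuousLinearEquiv.contDiff.comp_contDiffOn cN,
    hinj, ?_, ?_, ?_, ?_, ?_⟩
  · exact fun x _ => normal_unit A hN _
  · intro x hx v
    have := hnormal x hx v
    simp only [PiLp.inner_apply, Fin.sum_univ_three, RCLike.inner_apply, conj_trivial] at this
    linarith
  · intro x hx
    -- The orbit of a point is only known to be continuous in `M`, but its image is a smooth circle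
    -- or a point. Its velocity is therefore tangent to the surface, which puts the normal in the
    -- plane through the axis.
    obtain ⟨Φ, hΦ, hΦ0, -, hΦr⟩ := hsymm
    have hc : Continuous fun t => Φ t (φ.symm x) := hΦ.comp (Continuous.prodMk_left _)
    have hs : φ.symm x ∈ φ.source := φ.map_target hx
    have h1 : Filter.Tendsto (fun t => Φ t (φ.symm x)) (nhds 0) (nhds (φ.symm x)) := by
      simpa [hΦ0] using hc.tendsto 0
    have h2 : Filter.Tendsto (fun t => φ (Φ t (φ.symm x))) (nhds 0) (nhds x) := by
      have := (φ.continuousAt hs).tendsto.comp h1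
      rwa [φ.right_inv hx] at this
    have h3 := inner_deriv_eq_zero_of_lift
      ((cF.contDiffAt (φ.open_target.mem_nhds hx)).differentiableAt (by simp)).hasFDerivAt
      (hinj x hx) (hnormal x hx) h2 (hasDerivAt_rotateZ (A (f (φ.symm x)))) (by
        rw [← hΦr, hΦ0]) (by
        filter_upwards [h1.eventually (φ.open_source.mem_nhds hs)] with t ht
        rw [φ.left_inv ht, hΦr])
    simp [PiLp.inner_apply, Fin.sum_univ_three] at h3
    linarith
  · intro x hx v h0 h1
    rw [dF x hx] at h0 h1 ⊢
    rw [dG x hx, ← map_neg, ← map_smul]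
    exact congrArg _ (hk.parallel _ _ ⟨h0, h1⟩)
  · intro x hx v h0
    rw [dF x hx] at h0 ⊢
    rw [dG x hx, ← map_neg, ← map_smul]
    exact congrArg _ (hk.profile _ _ h0)

/-- A function on a connected surface whose derivative vanishes in all charts is constant. -/
theorem eq_of_hasFDerivAt_chart_zero [PreconnectedSpace M] {h : M → ℝ}
    (hd : ∀ p : M, ∀ x ∈ (chartAt EuclPlane p).target,
      HasFDerivAt (fun x => h ((chartAt EuclPlane p).symm x)) (0 : EuclPlane →L[ℝ] ℝ) x)
    (p q : M) : h p = h q := by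
  have : IsLocallyConstant h := by
    rw [IsLocallyConstant.iff_eventually_eq]
    intro p
    set φ := chartAt EuclPlane p with hφ
    have hp : p ∈ φ.source := mem_chart_source _ p
    obtain ⟨r, hr, hball⟩ := Metric.isOpen_iff.1 φ.open_target _ (φ.map_source hp)
    filter_upwards [φ.open_source.mem_nhds hp,
      (φ.continuousAt hp).eventually (Metric.ball_mem_nhds _ hr)] with y hy hyb
    have := Metric.isOpen_ball.is_const_of_fderiv_eq_zero (convex_ball _ _).isPreconnected
      (fun x hx => (hd p x (hball hx)).differentiableAt.differentiableWithinAt)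
      (fun x hx => (hd p x (hball hx)).fderiv) hyb (Metric.mem_ball_self hr)
    simpa only [← hφ, φ.left_inv hy, φ.left_inv hp] using this
  exact this.apply_eq_of_preconnectedSpace p q

end Surfaces

/-! ### Factorization of the Weingarten relation -/

/-- A continuous real function with finitely many values on a connected space is constant. -/
theorem eq_of_continuous_of_finite {X : Type*} [TopologicalSpace X] [PreconnectedSpace X]
    {h : X → ℝ} (hc : Continuous h) {s : Set ℝ} (hs : s.Finite) (hmem : ∀ x, h x ∈ s) (x y : X) :
    h x = h y :=
  (hs.countable.isTotallyDisconnected _ (Set.range_subset_iff.2 hmem) (isPreconnected_range hc))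
    ⟨x, rfl⟩ ⟨y, rfl⟩

/-- The factorization of a semi-quadratic Weingarten relation with `Λ₁² = Λ₂`. -/
theorem IsSemiQuadraticWeingarten.exists_eq_or_eq {M : Type*} [Nonempty M] {α β γ δ : ℝ}
    {k₁ k₂ : M → ℝ} (hW : IsSemiQuadraticWeingarten α β γ δ k₁ k₂)
    (hΛ : weingartenLambda₁ β γ ^ 2 = weingartenLambda₂ α β γ δ) :
    ∃ a b : ℝ, (∀ p, k₁ p = a ∨ k₂ p = b) := by
  have hdet : β * γ = α * δ := by
    rw [weingartenLambda₁, weingartenLambda₂] at hΛ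
    linarith
  have hrel := hW.relation
  by_cases hα : α = 0
  · subst hα
    rcases mul_eq_zero.1 (hdet.trans (zero_mul δ)) with rfl | rfl
    · have hγ : γ ≠ 0 := by
        rintro rfl
        obtain ⟨p⟩ := ‹Nonempty M›
        have hδ : δ = 0 := by simpa using hrel p
        exact hW.nontrivial (by simp [hδ])
      -- The relation fixes `k₂` alone; the value `0` for `a` is arbitrary.
      refine ⟨0, -δ / γ, fun p => Or.inr ?_⟩
      rw [eq_div_iff hγ]
      linarith [hrel p]
    · have hβ : β ≠ 0 := by
        rintro rfl
        obtain ⟨p⟩ := ‹Nonempty M›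
        have hδ : δ = 0 := by simpa using hrel p
        exact hW.nontrivial (by simp [hδ])
      -- The relation fixes `k₁` alone; the value for `b` is arbitrary.
      refine ⟨-δ / β, -δ / β, fun p => Or.inl ?_⟩
      rw [eq_div_iff hβ]
      linarith [hrel p]
  · refine ⟨-γ / α, -β / α, fun p => ?_⟩
    rw [eq_div_iff hα, eq_div_iff hα]
    have : (α * k₁ p + γ) * (α * k₂ p + β) = 0 := by linear_combination α * hrel p + hdet
    rcases mul_eq_zero.1 this with h | h
    · left; linarith
    · right; linarith

/-! ### Global consequences on the surface -/

section Surfaces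

variable {M : Type*} [TopologicalSpace M] [ChartedSpace EuclPlane M]
  [IsManifold 𝓘(ℝ, EuclPlane) 2 M]
  {A : EuclSpace ≃ᵃⁱ[ℝ] EuclSpace} {f N : M → EuclSpace} {k₁ k₂ : M → ℝ}

theorem continuous_profile_curvature (hf : IsC2ImmersedSurface f)
    (hsymm : IsRotationallySymmetric A f) (hN : IsUnitNormalField f N)
    (hk : ArePrincipalCurvatures A f N k₁ k₂) : Continuous k₂ := by
  refine continuous_iff_continuousAt.2 fun p => ?_
  have hp := mem_chart_source EuclPlane p
  have h := (isRotationalPatch_chart hf hsymm hN hk p).continuousAt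
    ((chartAt EuclPlane p).map_source hp)
  refine (ContinuousAt.comp (g := fun x => k₂ ((chartAt EuclPlane p).symm x)) h
    ((chartAt EuclPlane p).continuousAt hp)).congr ?_
  filter_upwards [(chartAt EuclPlane p).open_source.mem_nhds hp] with q hq
  simp [(chartAt EuclPlane p).left_inv hq]

theorem normal_radial (hf : IsC2ImmersedSurface f)
    (hsymm : IsRotationallySymmetric A f) (hN : IsUnitNormalField f N)
    (hk : ArePrincipalCurvatures A f N k₁ k₂) (p : M) :
    A (f p) 0 * A.linearIsometryEquiv (N p) 1 - A (f p) 1 * A.linearIsometryEquiv (N p) 0 = 0 := by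
  have hp := mem_chart_source EuclPlane p
  have h := (isRotationalPatch_chart hf hsymm hN hk p).radial _
    ((chartAt EuclPlane p).map_source hp)
  simpa only [(chartAt EuclPlane p).left_inv hp] using h

theorem normal_vertical_of_axis (hf : IsC2ImmersedSurface f)
    (hsymm : IsRotationallySymmetric A f) (hN : IsUnitNormalField f N)
    (hk : ArePrincipalCurvatures A f N k₁ k₂) (p : M) (h0 : A (f p) 0 = 0) (h1 : A (f p) 1 = 0) :
    A.linearIsometryEquiv (N p) 0 = 0 ∧ A.linearIsometryEquiv (N p) 1 = 0 := by
  have hp := mem_chart_source EuclPlane p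
  have hl := (chartAt EuclPlane p).left_inv hp
  have h := (isRotationalPatch_chart hf hsymm hN hk p).normal_of_axis
    ((chartAt EuclPlane p).map_source hp) (by simpa only [hl] using h0)
    (by simpa only [hl] using h1)
  simpa only [hl] using h

/-- Continuity of `k₂` makes `k₂ ≠ b` an open condition, so `k₁ = a` holds on a whole patch and can
be differentiated. -/
theorem profile_curvature_mem (hf : IsC2ImmersedSurface f)
    (hsymm : IsRotationallySymmetric A f) (hN : IsUnitNormalField f N)
    (hk : ArePrincipalCurvatures A f N k₁ k₂) {a b : ℝ} (hab : ∀ p, k₁ p = a ∨ k₂ p = b) (p : M) :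
    k₂ p ∈ ({a, 0, b} : Set ℝ) := by
  by_cases hb : k₂ p = b
  · simp [hb]
  have hp := mem_chart_source EuclPlane p
  have h := isRotationalPatch_chart hf hsymm hN hk p
  have hV := ContinuousOn.isOpen_inter_preimage
    (fun x hx => (h.continuousAt hx).continuousWithinAt) h.isOpen (isOpen_compl_singleton (x := b))
  have := (h.mono hV Set.inter_subset_left).eq_or_eq_zero_of_const
    (fun y hy => (hab _).resolve_right hy.2) (x := chartAt EuclPlane p p)
    ⟨(chartAt EuclPlane p).map_source hp, by simpa [(chartAt EuclPlane p).left_inv hp] using hb⟩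
  simp only [(chartAt EuclPlane p).left_inv hp] at this
  rcases this with h | h <;> simp [h]

variable [ConnectedSpace M]

/-! ### Classification for constant profile curvature -/

/-- Surfaces whose profile curves have constant nonzero curvature. -/
theorem torus_or_sphere_of_const (hf : IsC2ImmersedSurface f)
    (hsymm : IsRotationallySymmetric A f) (hN : IsUnitNormalField f N)
    (hk : ArePrincipalCurvatures A f N k₁ k₂) {r : ℝ} (hr : ∀ p, r * k₂ p = 1) :
    ∃ T : Set EuclSpace, (IsTorusOfRevolution T ∨ IsRoundSphere T) ∧ Set.range f ⊆ T := by
  obtain ⟨p₀⟩ := ‹ConnectedSpace M›.toNonempty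
  have hr0 : r ≠ 0 := by
    rintro rfl
    simpa using hr p₀
  have hQ := eq_of_hasFDerivAt_chart_zero
    (h := fun p => (A (f p) 0 + r * A.linearIsometryEquiv (N p) 0)
        * (A (f p) 0 + r * A.linearIsometryEquiv (N p) 0)
      + (A (f p) 1 + r * A.linearIsometryEquiv (N p) 1)
        * (A (f p) 1 + r * A.linearIsometryEquiv (N p) 1))
    (fun p x hx => (isRotationalPatch_chart hf hsymm hN hk p).hasFDerivAt_centre_dist
      (fun y _ => hr _) hx)
  have hZ := eq_of_hasFDerivAt_chart_zero
    (h := fun p => A (f p) 2 + r * A.linearIsometryEquiv (N p) 2)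
    (fun p x hx => (isRotationalPatch_chart hf hsymm hN hk p).hasFDerivAt_centre_height
      (fun y _ => hr _) hx)
  obtain ⟨z, hz⟩ : ∃ z, ∀ p, A (f p) 2 + r * A.linearIsometryEquiv (N p) 2 = z :=
    ⟨_, fun p => hZ p p₀⟩
  obtain ⟨R, hR0, hR⟩ : ∃ R, 0 ≤ R ∧ ∀ p, (A (f p) 0 + r * A.linearIsometryEquiv (N p) 0) ^ 2
      + (A (f p) 1 + r * A.linearIsometryEquiv (N p) 1) ^ 2 = R ^ 2 :=
    ⟨√((A (f p₀) 0 + r * A.linearIsometryEquiv (N p₀) 0) ^ 2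
      + (A (f p₀) 1 + r * A.linearIsometryEquiv (N p₀) 1) ^ 2), Real.sqrt_nonneg _, fun p => by
      rw [Real.sq_sqrt (by positivity)]
      simpa only [sq] using hQ p p₀⟩
  have hunit := normal_unit A hN
  -- `R` is the distance of the centre of curvature from the axis. The signed radius `r` may be
  -- negative, hence `|r|` in the witnesses.
  rcases hR0.eq_or_lt with rfl | hRpos
  · refine ⟨_, Or.inr ⟨A.symm !₂[0, 0, z], |r|, abs_pos.2 hr0, rfl⟩, ?_⟩
    rintro _ ⟨p, rfl⟩
    rw [mem_sphere_iff_norm, ← A.linearIsometryEquiv.norm_map, A.linear_sub,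
      ← sq_eq_sq₀ (norm_nonneg _) (abs_nonneg _), EuclSpace.norm_sq_eq, sq_abs]
    have hp := hR p
    have h0 : A (f p) 0 = -(r * A.linearIsometryEquiv (N p) 0) := by
      nlinarith [sq_nonneg (A (f p) 0 + r * A.linearIsometryEquiv (N p) 0),
        sq_nonneg (A (f p) 1 + r * A.linearIsometryEquiv (N p) 1)]
    have h1 : A (f p) 1 = -(r * A.linearIsometryEquiv (N p) 1) := by
      nlinarith [sq_nonneg (A (f p) 0 + r * A.linearIsometryEquiv (N p) 0),
        sq_nonneg (A (f p) 1 + r * A.linearIsometryEquiv (N p) 1)]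
    have h2 : A (f p) 2 - z = -(r * A.linearIsometryEquiv (N p) 2) := by linarith [hz p]
    simp only [AffineIsometryEquiv.apply_symm_apply, PiLp.sub_apply]
    simp [h0, h1, h2]
    linear_combination r ^ 2 * hunit p
  · refine ⟨_, Or.inl ⟨A.symm !₂[0, 0, z], A.linearIsometryEquiv.symm !₂[0, 0, 1], R, |r|,
      norm_frame A 1 (by norm_num), hRpos, abs_pos.2 hr0, rfl⟩, ?_⟩
    rintro _ ⟨p, rfl⟩
    rw [Set.mem_ofPred_eq, axisDist_frame A z 1 (by norm_num), axisHeight_frame, sq_abs]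
    set X := A (f p) with hX
    set G := A.linearIsometryEquiv (N p) with hG
    have hρ := Real.sq_sqrt (show 0 ≤ X 0 ^ 2 + X 1 ^ 2 by positivity)
    set ρ := √(X 0 ^ 2 + X 1 ^ 2)
    have hrad := normal_radial hf hsymm hN hk p
    rw [← hX, ← hG] at hrad
    have hRp := hR p
    have hzp := hz p
    have hup := hunit p
    rw [← hX, ← hG] at hRp
    rw [← hX, ← hG] at hzp
    rw [← hG] at hup
    -- By the radial identity, position and centre have parallel horizontal parts, so their inner
    -- product is `±ρR`. The sign decides which of the two torus equations holds, that is, whether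
    -- point and centre lie on the same side of the axis.
    have hsq : (X 0 * (X 0 + r * G 0) + X 1 * (X 1 + r * G 1)) ^ 2 = (ρ * R) ^ 2 := by
      rw [mul_pow, hρ, ← hRp]
      linear_combination -(r ^ 2 * (X 0 * G 1 - X 1 * G 0)) * hrad
    have hz2 : (X 2 - z) ^ 2 = r ^ 2 * G 2 ^ 2 := by rw [← hzp]; ring
    rcases sq_eq_sq_iff_eq_or_eq_neg.1 hsq with h | h
    · left
      linear_combination hρ + hz2 + r ^ 2 * hup - hRp + 2 * h
    · right
      linear_combination hρ + hz2 + r ^ 2 * hup - hRp + 2 * h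

/-- Surfaces whose profile curves are straight. -/
theorem plane_or_cone_or_cylinder_of_zero (hf : IsC2ImmersedSurface f)
    (hsymm : IsRotationallySymmetric A f) (hN : IsUnitNormalField f N)
    (hk : ArePrincipalCurvatures A f N k₁ k₂) (h0 : ∀ p, k₂ p = 0) :
    ∃ T : Set EuclSpace, (IsAffinePlane T ∨ IsCircularCone T ∨ IsCircularCylinder T) ∧
      Set.range f ⊆ T := by
  obtain ⟨p₀⟩ := ‹ConnectedSpace M›.toNonempty
  have hn := eq_of_hasFDerivAt_chart_zero (h := fun p => A.linearIsometryEquiv (N p) 2)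
    (fun p x hx => (isRotationalPatch_chart hf hsymm hN hk p).hasFDerivAt_normal_height
      (fun y _ => h0 _) hx)
  have hd := eq_of_hasFDerivAt_chart_zero
    (h := fun p => A (f p) 0 * A.linearIsometryEquiv (N p) 0
      + A (f p) 1 * A.linearIsometryEquiv (N p) 1 + A (f p) 2 * A.linearIsometryEquiv (N p) 2)
    (fun p x hx => (isRotationalPatch_chart hf hsymm hN hk p).hasFDerivAt_support
      (fun y _ => h0 _) hx)
  obtain ⟨n, hn⟩ : ∃ n, ∀ p, A.linearIsometryEquiv (N p) 2 = n := ⟨_, fun p => hn p p₀⟩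
  obtain ⟨d, hd⟩ : ∃ d, ∀ p, A (f p) 0 * A.linearIsometryEquiv (N p) 0
      + A (f p) 1 * A.linearIsometryEquiv (N p) 1 + A (f p) 2 * A.linearIsometryEquiv (N p) 2 = d :=
    ⟨_, fun p => hd p p₀⟩
  have hunit := normal_unit A hN
  simp only [hn] at hd hunit
  by_cases hn1 : n ^ 2 = 1
  · refine ⟨_, Or.inl ⟨A.symm !₂[0, 0, n * d], A.linearIsometryEquiv.symm !₂[0, 0, 1],
      norm_frame A 1 (by norm_num), rfl⟩, ?_⟩
    rintro _ ⟨p, rfl⟩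
    rw [Set.mem_ofPred_eq, axisHeight_frame]
    have hs : A.linearIsometryEquiv (N p) 0 ^ 2 + A.linearIsometryEquiv (N p) 1 ^ 2 = 0 := by
      linarith [hunit p]
    have hG0 : A.linearIsometryEquiv (N p) 0 = 0 := by
      nlinarith [sq_nonneg (A.linearIsometryEquiv (N p) 0), sq_nonneg (A.linearIsometryEquiv (N p) 1)]
    have hG1 : A.linearIsometryEquiv (N p) 1 = 0 := by
      nlinarith [sq_nonneg (A.linearIsometryEquiv (N p) 0), sq_nonneg (A.linearIsometryEquiv (N p) 1)]
    have := hd p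
    rw [hG0, hG1] at this
    linear_combination n * this - A (f p) 2 * hn1
  -- A surface point on the axis would have a vertical normal, that is `n² = 1`.
  have hpos (p : M) : 0 < A (f p) 0 ^ 2 + A (f p) 1 ^ 2 := by
    refine lt_of_le_of_ne (by positivity) fun hz => hn1 ?_
    obtain ⟨e0, e1⟩ := normal_vertical_of_axis hf hsymm hN hk p
      (by nlinarith [sq_nonneg (A (f p) 0), sq_nonneg (A (f p) 1)])
      (by nlinarith [sq_nonneg (A (f p) 0), sq_nonneg (A (f p) 1)])
    have := hunit p
    rw [e0, e1] at this
    linarith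
  have cX (i : Fin 3) : Continuous fun p => A (f p) i :=
    (EuclideanSpace.proj (𝕜 := ℝ) i).continuous.comp (A.continuous.comp hf.contMDiff.continuous)
  have cG (i : Fin 3) : Continuous fun p => A.linearIsometryEquiv (N p) i :=
    (EuclideanSpace.proj (𝕜 := ℝ) i).continuous.comp
      (A.linearIsometryEquiv.continuous.comp hN.contMDiff.continuous)
  -- `s` is the component of the normal pointing away from the axis. Its square is the constant `1 -
  -- n²`, so by continuity and connectedness its sign does not change.
  set s : M → ℝ := fun p => (A (f p) 0 * A.linearIsometryEquiv (N p) 0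
      + A (f p) 1 * A.linearIsometryEquiv (N p) 1) / √(A (f p) 0 ^ 2 + A (f p) 1 ^ 2) with hs
  have cs : Continuous s :=
    (((cX 0).mul (cG 0)).add ((cX 1).mul (cG 1))).div
      (Real.continuous_sqrt.comp (((cX 0).pow 2).add ((cX 1).pow 2)))
      fun p => (Real.sqrt_pos.2 (hpos p)).ne'
  have hs2 (p : M) : s p ^ 2 = 1 - n ^ 2 := by
    simp only [hs]
    rw [div_pow, Real.sq_sqrt (hpos p).le, div_eq_iff (hpos p).ne']
    linear_combination (A (f p) 0 ^ 2 + A (f p) 1 ^ 2) * hunit p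
      - (A (f p) 0 * A.linearIsometryEquiv (N p) 1 - A (f p) 1 * A.linearIsometryEquiv (N p) 0)
        * normal_radial hf hsymm hN hk p
  have hsc := eq_of_continuous_of_finite cs (Set.toFinite {s p₀, -s p₀}) fun p => by
    have : s p ^ 2 = s p₀ ^ 2 := by rw [hs2, hs2]
    simpa using sq_eq_sq_iff_eq_or_eq_neg.1 this
  obtain ⟨σ, hσ⟩ : ∃ σ, ∀ p, s p = σ := ⟨_, fun p => hsc p p₀⟩
  have hσ2 : σ ^ 2 = 1 - n ^ 2 := by rw [← hσ p₀, hs2]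
  have hσ0 : σ ≠ 0 := by
    rintro rfl
    exact hn1 (by linarith)
  -- This is the line containing the profile curves in the half-plane of distance and height.
  have hline (p : M) : σ * √(A (f p) 0 ^ 2 + A (f p) 1 ^ 2) + n * A (f p) 2 = d := by
    have h1 := hσ p
    simp only [hs] at h1
    rw [div_eq_iff (Real.sqrt_pos.2 (hpos p)).ne'] at h1
    rw [← h1, ← hd p]
    ring
  by_cases hn0 : n = 0
  · have hdp (p : M) : √(A (f p) 0 ^ 2 + A (f p) 1 ^ 2) = d / σ := by
      rw [eq_div_iff hσ0, ← hline p, hn0]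
      ring
    refine ⟨_, Or.inr (Or.inr ⟨A.symm !₂[0, 0, 0], A.linearIsometryEquiv.symm !₂[0, 0, 1], d / σ,
      norm_frame A 1 (by norm_num), ?_, rfl⟩), ?_⟩
    · rw [← hdp p₀]
      exact Real.sqrt_pos.2 (hpos p₀)
    · rintro _ ⟨p, rfl⟩
      rw [Set.mem_ofPred_eq, axisDist_frame A 0 1 (by norm_num), hdp]
  -- The line meets the axis at height `d / n`, the apex. The sign `ε` directs the axis into the
  -- nappe containing the surface, which makes the slope positive.
  · obtain ⟨ε, hε, hm⟩ : ∃ ε : ℝ, ε ^ 2 = 1 ∧ 0 < -(ε * (n / σ)) := by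
      rcases lt_or_gt_of_ne (div_ne_zero hn0 hσ0) with h | h
      · exact ⟨1, by norm_num, by linarith⟩
      · exact ⟨-1, by norm_num, by linarith⟩
    refine ⟨_, Or.inr (Or.inl ⟨A.symm !₂[0, 0, d / n], A.linearIsometryEquiv.symm !₂[0, 0, ε],
      -(ε * (n / σ)), norm_frame A ε hε, hm, rfl⟩), ?_⟩
    rintro _ ⟨p, rfl⟩
    rw [Set.mem_ofPred_eq, axisDist_frame A _ ε hε, axisHeight_frame]
    have e1 : -(ε * (n / σ)) * (ε * (A (f p) 2 - d / n)) = -(n / σ) * (A (f p) 2 - d / n) := by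
      linear_combination -(n / σ) * (A (f p) 2 - d / n) * hε
    rw [e1]
    field_simp
    linear_combination hline p

end Surfaces

theorem theorem4p19 {M : Type*} [TopologicalSpace M] [ConnectedSpace M]
    [ChartedSpace EuclPlane M] [IsManifold 𝓘(ℝ, EuclPlane) 2 M]
    (A : EuclSpace ≃ᵃⁱ[ℝ] EuclSpace) (f N : M → EuclSpace) (k₁ k₂ : M → ℝ) (α β γ δ : ℝ)
    (hf : IsC2ImmersedSurface f) (hsymm : IsRotationallySymmetric A f)
    (hN : IsUnitNormalField f N) (hk : ArePrincipalCurvatures A f N k₁ k₂)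
    (hW : IsSemiQuadraticWeingarten α β γ δ k₁ k₂)
    (hΛ : weingartenLambda₁ β γ ^ 2 = weingartenLambda₂ α β γ δ) :
    ∃ T : Set EuclSpace,
      (IsTorusOfRevolution T ∨ IsRoundSphere T ∨ IsAffinePlane T ∨ IsCircularCone T ∨
        IsCircularCylinder T) ∧ Set.range f ⊆ T := by
  obtain ⟨p₀⟩ := ‹ConnectedSpace M›.toNonempty
  obtain ⟨a, b, hab⟩ := hW.exists_eq_or_eq hΛ
  have hconst := fun p => eq_of_continuous_of_finite (continuous_profile_curvature hf hsymm hN hk)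
    (Set.toFinite {a, 0, b}) (profile_curvature_mem hf hsymm hN hk hab) p p₀
  by_cases h0 : k₂ p₀ = 0
  · obtain ⟨T, hT, hfT⟩ := plane_or_cone_or_cylinder_of_zero hf hsymm hN hk
      fun p => (hconst p).trans h0
    exact ⟨T, Or.inr (Or.inr hT), hfT⟩
  · obtain ⟨T, hT, hfT⟩ := torus_or_sphere_of_const (r := (k₂ p₀)⁻¹) hf hsymm hN hk
      fun p => by rw [hconst p, inv_mul_cancel₀ h0]
    exact ⟨T, by tauto, hfT⟩
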